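/- A finite poset $P$ with minimum $\hat 0$ and maximum $\hat 1$ is $n$-graded with rank function $\rho\colon P\to\mathbb N$ if every maximal chain is of the form $\hat 0=x_0\lessdot x_1\lessdot\cdots\lessdot x_n=\hat 1$ with $\rho(x_i)=i$. A finite lattice is geometric if it is graded, $\rho(p)+\rho(q)\ge\rho(p\vee q)+\rho(p\wedge q)$ for all $p,q$, and every element is a join of atoms; an element $p$ is modular if $\rho(p)+\rho(q)=\rho(p\vee q)+\rho(p\wedge q)$ for all $q$. A uniform sequence of supersolvable geometric lattices consists of finite geometric lattices $L_0,L_1,L_2,\ldots$ with $L_n$ being $n$-graded, an isomorphism $\theta_s\colon[s,\hat 1_{L_n}]\to L_{n-1}$ for every $n\ge 1$ and every atom $s\in L_n$, and for every $n\ge 0$ an order embedding $\iota_n\colon L_n\to L_{n+1}$ whose image is $[\hat 0_{L_{n+1}},t_n]$ for a modular coatom $t_n\in L_{n+1}$, such that $\iota_{n-1}(\theta_s(x))=\theta_{\iota_n(s)}(\iota_n(x))$ for all $n\ge 1$, all atoms $s\in L_n$ and all $x\in[s,\hat 1_{L_n}]$. Given such a sequence, let $\mathcal L_\infty=\bigsqcup_{n\ge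 0}L_n/\!\sim$, where $\sim$ is the equivalence relation generated by $x\sim\iota_n(x)$ for all $n$ and all $x\in L_n$, ordered by $[x]\le[y]$ if $x'\le y'$ in some $L_n$ for some representatives $x'\in[x]$, $y'\in[y]$ in $L_n$. Put $\rho([x])=\rho(x)$ and $\nu([x])=\min\{n : [x]\text{ has a representative in }L_n\}$, and for $k\ge 1$ let $\mathcal L^{(k)}_\infty=\{p\in\mathcal L_\infty : \nu(p)-\rho(p)<k\}$ with the induced order. For $n\ge 1$ let $a_n=\#\{\text{atoms of }L_n\}-\#\{\text{atoms of }L_{n-1}\}$. Then for every $k\ge 1$ the poset $\mathcal L^{(k)}_\infty$ is $\mathbb N$-graded with rank function $\rho$ (it has a minimum $\hat 0$, and every maximal chain is of the form $\hat 0=x_0\lessdot x_1\lessdot x_2\lessdot\cdots$ with $\rho(x_i)=i$), it has finitely many elements of each rank, and its rank generating function $F(\mathcal L^{(k)}_\infty;x)=\sum_{p\in\mathcal L^{(k)}_\infty}x^{\rho(p)}$ is $$F(\mathcal L^{(k)}_\infty;x)=\frac{1}{(1-a_1x)(1-a_2x)\cdots(1-a_kx)}$$ as a formal power series. -/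

import Mathlib

universe u

/-! ### Finite graded posets and geometric lattices -/

/-- `P` is `n`-graded with rank function `ρ`: every maximal chain of `P` is of the form
`⊥ = x₀ ⋖ x₁ ⋖ ⋯ ⋖ xₙ = ⊤` with `ρ (xᵢ) = i` (so the level `Pᵢ` is the fibre of `ρ` over `i`).
As every element lies in a maximal chain, `ρ` is determined by the order of `P`. -/
def IsGradedBy {P : Type*} [PartialOrder P] [BoundedOrder P] (n : ℕ) (ρ : P → ℕ) : Prop :=
  ∀ C : Set P, IsMaxChain (· ≤ ·) C →
    ∃ x : ℕ → P, x 0 = ⊥ ∧ x n = ⊤ ∧ (∀ i < n, x i ⋖ x (i + 1)) ∧ (∀ i ≤ n, ρ (x i) = i) ∧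
      C = x '' Set.Iic n

/-- An arbitrary poset `P` is `ℕ`-graded with rank function `ρ`: it has a minimum, and every maximal
chain of `P` is of the form `⊥ = x₀ ⋖ x₁ ⋖ x₂ ⋖ ⋯` with `ρ (xᵢ) = i`. -/
def IsNatGradedBy {P : Type*} [PartialOrder P] (ρ : P → ℕ) : Prop :=
  ∃ b : P, IsBot b ∧ ∀ C : Set P, IsMaxChain (· ≤ ·) C →
    ∃ x : ℕ → P, x 0 = b ∧ (∀ i, x i ⋖ x (i + 1)) ∧ (∀ i, ρ (x i) = i) ∧ C = Set.range x

/-- A graded poset with rank function `ρ` is of finite type if it has finitely many elements of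
each rank. -/
def IsFiniteType {P : Type*} (ρ : P → ℕ) : Prop :=
  ∀ i : ℕ, {p : P | ρ p = i}.Finite

/-- The rank generating function `∑ₚ x ^ ρ(p)` of a poset of finite type with rank function `ρ`:
the coefficient of `x ^ i` is the number of elements of rank `i`. -/
noncomputable def rankGenFun {P : Type*} (ρ : P → ℕ) : PowerSeries ℚ :=
  PowerSeries.mk fun i => (Nat.card {p : P // ρ p = i} : ℚ)

/-- `L` is a geometric lattice of rank `n` with rank function `ρ`: it is `n`-graded, (upper)
semimodular, and every element is a join of atoms. -/
structure IsGeometric {L : Type*} [Lattice L] [BoundedOrder L] (n : ℕ) (ρ : L → ℕ) : Prop where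
  graded : IsGradedBy n ρ
  semimodular : ∀ p q : L, ρ (p ⊔ q) + ρ (p ⊓ q) ≤ ρ p + ρ q
  atomic : IsAtomistic L

/-- An element `p` is modular (with respect to the rank function `ρ`). -/
def IsModularElement {L : Type*} [Lattice L] (ρ : L → ℕ) (p : L) : Prop :=
  ∀ q : L, ρ p + ρ q = ρ (p ⊔ q) + ρ (p ⊓ q)

/-! ### Helper facts on rank functions and embeddings onto lower intervals -/

section Helpers

theorem IsGradedBy.rank_bot {P : Type*} [PartialOrder P] [BoundedOrder P] {n : ℕ} {ρ : P → ℕ}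
    (h : IsGradedBy n ρ) : ρ ⊥ = 0 := by
  obtain ⟨C, hC, -⟩ := IsChain.exists_maxChain (IsChain.empty (r := ((· ≤ ·) : P → P → Prop)))
  obtain ⟨x, h0, -, -, hr, -⟩ := h C hC
  rw [← h0]
  exact hr 0 (Nat.zero_le n)

theorem IsGradedBy.rank_covBy {P : Type*} [PartialOrder P] [BoundedOrder P] {n : ℕ} {ρ : P → ℕ}
    (h : IsGradedBy n ρ) {a b : P} (hab : a ⋖ b) : ρ b = ρ a + 1 := by
  have hch : IsChain (· ≤ ·) ({a, b} : Set P) :=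
    IsChain.pair hab.le
  obtain ⟨C, hC, hsub⟩ := IsChain.exists_maxChain hch
  obtain ⟨x, -, -, hcov, hr, rfl⟩ := h C hC
  obtain ⟨i, hi, hia⟩ := hsub (Set.mem_insert a {b})
  obtain ⟨j, hj, hjb⟩ := hsub (Set.mem_insert_of_mem a rfl)
  have hi' : i ≤ n := hi
  have hj' : j ≤ n := hj
  have hmono : ∀ m, m ≤ n → ∀ l, l ≤ m → x l ≤ x m := by
    intro m
    induction m with
    | zero => intro _ l hl; rw [Nat.le_zero.mp hl]
    | succ m ih =>
      intro hm l hl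
      rcases Nat.lt_or_ge l (m + 1) with h1 | h1
      · exact (ih (by omega) l (by omega)).trans (hcov m (by omega)).le
      · rw [le_antisymm hl h1]
  have hij : i < j := by
    by_contra hcon
    have := hmono i hi' j (not_lt.mp hcon)
    rw [hia, hjb] at this
    exact absurd hab.lt (not_lt_of_ge this)
  have h2 : x (i + 1) ≤ b := hjb ▸ hmono j hj' (i + 1) hij
  have h3 : a < x (i + 1) := hia ▸ (hcov i (by omega)).lt
  have h4 : x (i + 1) = b := by
    by_contra hne
    exact hab.2 h3 (lt_of_le_of_ne h2 hne)
  rw [← h4, ← hia, hr i hi', hr (i + 1) (by omega)]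

theorem map_bot_of_range_eq_Iic {P Q : Type*} [PartialOrder P] [PartialOrder Q] [OrderBot P]
    [OrderBot Q] (f : P ↪o Q) {t : Q} (hf : Set.range f = Set.Iic t) : f ⊥ = ⊥ := by
  obtain ⟨x, hx⟩ : (⊥ : Q) ∈ Set.range f := by rw [hf]; exact bot_le
  apply le_antisymm _ bot_le
  rw [← hx]
  exact f.monotone bot_le

theorem map_covBy_of_range_eq_Iic {P Q : Type*} [PartialOrder P] [PartialOrder Q]
    (f : P ↪o Q) {t : Q} (hf : Set.range f = Set.Iic t) {a b : P} (hab : a ⋖ b) : f a ⋖ f b :=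
  hab.image f (by rw [hf]; exact Set.ordConnected_Iic)

theorem map_isAtom_of_range_eq_Iic {P Q : Type*} [PartialOrder P] [PartialOrder Q] [OrderBot P]
    [OrderBot Q] (f : P ↪o Q) {t : Q} (hf : Set.range f = Set.Iic t) {s : P} (hs : IsAtom s) :
    IsAtom (f s) := by
  have h := map_covBy_of_range_eq_Iic f hf (bot_covBy_iff.mpr hs)
  rw [map_bot_of_range_eq_Iic f hf] at h
  exact bot_covBy_iff.mp h

end Helpers

/-! ### Uniform sequences of supersolvable geometric lattices -/

/-- The data making `L₀, L₁, L₂, …` a uniform sequence of supersolvable geometric lattices. The fields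
`rank` and `t` are determined by the other data (`t n` is the image of the maximum of `L n`). Since
`L 0` has no atoms, the maps `θ` are indexed so that they start at atoms of `L 1`. -/
structure UniformSupersolvableSeq (L : ℕ → Type u) [∀ n, Lattice (L n)]
    [∀ n, BoundedOrder (L n)] [∀ n, Finite (L n)] where
  /-- the rank function of `L n` -/
  rank : ∀ n, L n → ℕ
  geometric : ∀ n, IsGeometric n (rank n)
  /-- the isomorphism from the interval `[s, ⊤]` of `L (n + 1)` to `L n`, for an atom `s` -/
  θ : ∀ (n : ℕ) (s : L (n + 1)), IsAtom s → (Set.Ici s ≃o L n)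
  /-- the embedding of `L n` into `L (n + 1)` -/
  ι : ∀ n, L n ↪o L (n + 1)
  /-- the distinguished modular coatom of `L (n + 1)` -/
  t : ∀ n, L (n + 1)
  isCoatom_t : ∀ n, IsCoatom (t n)
  isModular_t : ∀ n, IsModularElement (rank (n + 1)) (t n)
  range_ι : ∀ n, Set.range (ι n) = Set.Iic (t n)
  compat : ∀ (n : ℕ) (s : L (n + 1)) (hs : IsAtom s) (x : L (n + 1)) (hx : s ≤ x),
    ι n (θ n s hs ⟨x, hx⟩) =
      θ (n + 1) (ι (n + 1) s) (map_isAtom_of_range_eq_Iic (ι (n + 1)) (range_ι (n + 1)) hs)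
        ⟨ι (n + 1) x, (ι (n + 1)).monotone hx⟩

/-- The number of atoms of a poset with minimum. -/
noncomputable def numAtoms (P : Type*) [PartialOrder P] [OrderBot P] : ℕ :=
  Nat.card {s : P // IsAtom s}

/-- The integers `aₙ = #{atoms of Lₙ} - #{atoms of Lₙ₋₁}`, for `n ≥ 1`. -/
noncomputable def atomDiff (L : ℕ → Type u) [∀ n, Lattice (L n)] [∀ n, BoundedOrder (L n)]
    (n : ℕ) : ℤ :=
  (numAtoms (L n) : ℤ) - (numAtoms (L (n - 1)) : ℤ)

namespace UniformSupersolvableSeq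

variable {L : ℕ → Type u} [∀ n, Lattice (L n)] [∀ n, BoundedOrder (L n)] [∀ n, Finite (L n)]
  (S : UniformSupersolvableSeq L)

theorem rank_ι (n : ℕ) (x : L n) : S.rank (n + 1) (S.ι n x) = S.rank n x := by
  induction x using WellFoundedLT.induction with
  | ind x ih =>
    rcases eq_or_ne x ⊥ with rfl | hx
    · rw [map_bot_of_range_eq_Iic _ (S.range_ι n), (S.geometric n).graded.rank_bot,
        (S.geometric (n + 1)).graded.rank_bot]
    · obtain ⟨y, hy⟩ := exists_covBy_of_wellFoundedGT (a := x) (by rwa [isMin_iff_eq_bot])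
      rw [(S.geometric n).graded.rank_covBy hy,
        (S.geometric (n + 1)).graded.rank_covBy
          (map_covBy_of_range_eq_Iic _ (S.range_ι n) hy), ih y hy.lt]

/-! ### The direct limit -/

/-- The relation `x ∼ ι n x` on the disjoint union of the `L n`. -/
inductive Step : (Σ n, L n) → (Σ n, L n) → Prop
  | step (n : ℕ) (x : L n) : Step ⟨n, x⟩ ⟨n + 1, S.ι n x⟩

/-- The direct limit of the `L n` along the embeddings `ι n`: the disjoint union modulo the
equivalence relation generated by `x ∼ ι n x`. -/
def Limit : Type u := Quot S.Step

/-- The class in the limit of an element of `L n`. -/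
def toLimit (n : ℕ) (x : L n) : S.Limit := Quot.mk S.Step ⟨n, x⟩

theorem toLimit_ι (n : ℕ) (x : L n) : S.toLimit (n + 1) (S.ι n x) = S.toLimit n x :=
  (Quot.sound (Step.step n x)).symm

theorem exists_toLimit (p : S.Limit) : ∃ n x, S.toLimit n x = p := by
  induction p using Quot.ind with
  | mk a => exact ⟨a.1, a.2, rfl⟩

/-- The composite embedding `L n → L m` for `n ≤ m`. -/
def up {n m : ℕ} (h : n ≤ m) (x : L n) : L m :=
  Nat.leRecOn h (fun {k} => S.ι k) x

theorem up_self {n : ℕ} (x : L n) : S.up le_rfl x = x :=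
  Nat.leRecOn_self x

theorem up_succ {n m : ℕ} (h : n ≤ m) (x : L n) :
    S.up (Nat.le_succ_of_le h) x = S.ι m (S.up h x) :=
  Nat.leRecOn_succ h x

theorem up_ι {n m : ℕ} (h : n + 1 ≤ m) (x : L n) :
    S.up h (S.ι n x) = S.up ((Nat.le_succ n).trans h) x := by
  induction m, h using Nat.le_induction with
  | base => rw [up_self, up_succ S le_rfl, up_self]
  | succ m hm ih => rw [up_succ S hm, ih, ← up_succ]

theorem up_up {n m l : ℕ} (h : n ≤ m) (h' : m ≤ l) (x : L n) :
    S.up h' (S.up h x) = S.up (h.trans h') x := by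
  induction l, h' using Nat.le_induction with
  | base => rw [up_self]
  | succ l hl ih => rw [up_succ S hl, ih, ← up_succ]

theorem up_le_up {n m : ℕ} (h : n ≤ m) {x y : L n} : S.up h x ≤ S.up h y ↔ x ≤ y := by
  induction m, h using Nat.le_induction with
  | base => rw [up_self, up_self]
  | succ m hm ih => rw [up_succ S hm, up_succ S hm, (S.ι m).le_iff_le, ih]

theorem toLimit_up {n m : ℕ} (h : n ≤ m) (x : L n) : S.toLimit m (S.up h x) = S.toLimit n x := by
  induction m, h using Nat.le_induction with
  | base => rw [up_self]
  | succ m hm ih => rw [up_succ S hm, toLimit_ι, ih]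

theorem up_eq_of_toLimit_eq {n m : ℕ} {x : L n} {y : L m} (h : S.toLimit n x = S.toLimit m y) :
    ∃ (N : ℕ) (hn : n ≤ N) (hm : m ≤ N), S.up hn x = S.up hm y := by
  have key : ∀ a b : Σ n, L n, Relation.EqvGen S.Step a b →
      ∃ (N : ℕ) (hn : a.1 ≤ N) (hm : b.1 ≤ N), S.up hn a.2 = S.up hm b.2 := by
    intro a b hab
    induction hab with
    | rel a b hab =>
      cases hab with
      | step n x => exact ⟨n + 1, Nat.le_succ n, le_rfl, by rw [up_self, up_succ S le_rfl, up_self]⟩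
    | refl a => exact ⟨a.1, le_rfl, le_rfl, rfl⟩
    | symm a b _ ih =>
      obtain ⟨N, h1, h2, h3⟩ := ih
      exact ⟨N, h2, h1, h3.symm⟩
    | trans a b c _ _ ih1 ih2 =>
      obtain ⟨N, h1, h2, h3⟩ := ih1
      obtain ⟨M, g1, g2, g3⟩ := ih2
      refine ⟨max N M, h1.trans (le_max_left _ _), g2.trans (le_max_right _ _), ?_⟩
      rw [← S.up_up h1 (le_max_left N M), h3, S.up_up, ← S.up_up g2 (le_max_right N M), ← g3,
        S.up_up]
  exact key ⟨n, x⟩ ⟨m, y⟩ (Quot.eqvGen_exact h)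

theorem toLimit_injective (n : ℕ) {x y : L n} (h : S.toLimit n x = S.toLimit n y) : x = y := by
  obtain ⟨N, hn, hm, hxy⟩ := S.up_eq_of_toLimit_eq h
  exact le_antisymm ((S.up_le_up hn).mp hxy.le) ((S.up_le_up hn).mp hxy.ge)

/-- `p ≤ q` in the limit if `x ≤ y` in some `L n` for some representatives `x`, `y` in `L n`. -/
instance : LE S.Limit :=
  ⟨fun p q => ∃ (n : ℕ) (x y : L n), S.toLimit n x = p ∧ S.toLimit n y = q ∧ x ≤ y⟩

theorem le_def {p q : S.Limit} :
    p ≤ q ↔ ∃ (n : ℕ) (x y : L n), S.toLimit n x = p ∧ S.toLimit n y = q ∧ x ≤ y :=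
  Iff.rfl

theorem toLimit_le_toLimit {n : ℕ} {x y : L n} : S.toLimit n x ≤ S.toLimit n y ↔ x ≤ y := by
  refine ⟨?_, fun h => ⟨n, x, y, rfl, rfl, h⟩⟩
  rintro ⟨m, x', y', hx, hy, hle⟩
  have hx' : S.up (le_max_left n m) x = S.up (le_max_right n m) x' :=
    S.toLimit_injective _ (by rw [toLimit_up, toLimit_up, hx])
  have hy' : S.up (le_max_left n m) y = S.up (le_max_right n m) y' :=
    S.toLimit_injective _ (by rw [toLimit_up, toLimit_up, hy])
  rw [← S.up_le_up (le_max_left n m), hx', hy', S.up_le_up]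
  exact hle

instance : PartialOrder S.Limit where
  le_refl p := by
    obtain ⟨n, x, rfl⟩ := S.exists_toLimit p
    exact S.toLimit_le_toLimit.mpr le_rfl
  le_trans := by
    rintro p q r ⟨n, x, y, rfl, rfl, hxy⟩ ⟨m, y', z, hy, rfl, hyz⟩
    have hy' : S.up (le_max_right n m) y' = S.up (le_max_left n m) y :=
      S.toLimit_injective _ (by rw [toLimit_up, toLimit_up, hy])
    refine ⟨max n m, S.up (le_max_left n m) x, S.up (le_max_right n m) z, S.toLimit_up _ _,
      S.toLimit_up _ _, ?_⟩
    exact ((S.up_le_up _).mpr hxy).trans (hy' ▸ (S.up_le_up _).mpr hyz)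
  le_antisymm := by
    rintro p q ⟨n, x, y, rfl, rfl, hxy⟩ hqp
    rw [le_antisymm hxy (S.toLimit_le_toLimit.mp hqp)]

/-- The rank in the limit: `ρ [x] = ρ x`. -/
def limitRank : S.Limit → ℕ :=
  Quot.lift (fun a => S.rank a.1 a.2) (by rintro _ _ ⟨n, x⟩; exact (S.rank_ι n x).symm)

/-- `ν p` is the least `n` such that `p` has a representative in `L n`. -/
noncomputable def ν (p : S.Limit) : ℕ :=
  sInf {n : ℕ | ∃ x : L n, S.toLimit n x = p}

/-- The trimmed limit, the subposet of all `p` in the limit with `ν p - ρ p < k` (as integers). -/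
def Trimmed (k : ℕ) : Set S.Limit :=
  {p | (S.ν p : ℤ) - (S.limitRank p : ℤ) < (k : ℤ)}

/-- The rank of an element of the trimmed limit is its rank in the limit. -/
def trimmedRank (k : ℕ) (p : S.Trimmed k) : ℕ :=
  S.limitRank p.1

end UniformSupersolvableSeq

/-!
For `p ∈ L n` of rank `j`, iterating the isomorphisms `θ` identifies `[p, ⊤]` with `L (n - j)`, so
`p` has as many covers as `L (n - j)` has atoms (`ncard_covers`). The elements of rank `i + 1` of
`L (n + 1)` that are not below the modular coatom `t n` are, by modularity, exactly the covers
outside `[⊥, t n]` of a unique element `r = q ⊓ t n` of rank `i` of `L n`. There are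
`numAtoms (L (n + 1 - i)) - numAtoms (L (n - i))` of them over each `r`: all covers in `L (n + 1)`,
minus those which already lie in `L n`. This gives the recursion `rankCount_succ_succ`
`W (n + 1, i + 1) = W (n, i + 1) + a_{n + 1 - i} W (n, i)` for the numbers of elements of each rank.

An element `p` of rank `i` of the limit lies in the trimmed limit exactly if it comes from
`L (k - 1 + i)`, so the coefficients of the rank generating function are `W (k - 1 + i, i)`. The
recursion says that multiplying the generating function for `k + 1` by `1 - a_{k + 1} x` gives the
one for `k`.

The trimmed limit is graded because an interval `p < q` of it of length at least two contains an
element `r` of rank `ρ q - 1` that is again in the trimmed limit (`exists_between_trimmed`): with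
`m + 1 = ν q`, one takes `r = q ⊓ t m` if `p` lies below `t m`, which lowers `ν` and `ρ` together,
and otherwise `ν p = ν q`, so that any `r ∈ [p, q]` of that rank works. There are no maximal elements, because
joining `p` with an atom of `L (ν p + 1)` outside `L (ν p)` raises `ν` and `ρ` by one.
-/

/-! ### Rank functions of finite graded posets -/

section Graded

variable {P : Type*} [PartialOrder P] [BoundedOrder P] {n : ℕ} {ρ : P → ℕ}

theorem IsGradedBy.rank_top (h : IsGradedBy n ρ) : ρ ⊤ = n := by
  obtain ⟨C, hC, -⟩ := IsChain.exists_maxChain (IsChain.empty (r := ((· ≤ ·) : P → P → Prop)))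
  obtain ⟨x, -, hn, -, hr, -⟩ := h C hC
  rw [← hn]
  exact hr n le_rfl

theorem IsGradedBy.rank_strictMono [Finite P] (h : IsGradedBy n ρ) : StrictMono ρ := by
  intro a b hab
  induction b using WellFoundedLT.induction with
  | ind b ih =>
    obtain ⟨c, hac, hcb⟩ := exists_le_covBy_of_lt hab
    have := h.rank_covBy hcb
    rcases hac.eq_or_lt with rfl | hac
    · omega
    · have := ih c hcb.lt hac
      omega

theorem IsGradedBy.rank_le [Finite P] (h : IsGradedBy n ρ) (a : P) : ρ a ≤ n :=
  h.rank_top ▸ h.rank_strictMono.monotone le_top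

theorem IsGradedBy.covBy_of_rank [Finite P] (h : IsGradedBy n ρ) {a b : P} (hab : a ≤ b)
    (hr : ρ b = ρ a + 1) : a ⋖ b := by
  refine ⟨lt_of_le_of_ne hab (by rintro rfl; omega), fun c hac hcb => ?_⟩
  have := h.rank_strictMono hac
  have := h.rank_strictMono hcb
  omega

end Graded

/-- An order embedding with convex range identifies the covers of `a` with those covers of `f a`
which lie in the range. -/
theorem ncard_covers_mem_range {P Q : Type*} [PartialOrder P] [PartialOrder Q] (f : P ↪o Q)
    (hf : (Set.range f).OrdConnected) (a : P) :
    {q | f a ⋖ q ∧ q ∈ Set.range f}.ncard = {b | a ⋖ b}.ncard := by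
  rw [← Set.ncard_image_of_injective {b | a ⋖ b} f.injective]
  congr 1
  ext q
  constructor
  · rintro ⟨hq, b, rfl⟩
    exact ⟨b, (hf.apply_covBy_apply_iff f).mp hq, rfl⟩
  · rintro ⟨b, hb, rfl⟩
    exact ⟨(hf.apply_covBy_apply_iff f).mpr hb, b, rfl⟩

theorem numAtoms_eq_ncard_covers_bot (P : Type*) [PartialOrder P] [OrderBot P] :
    numAtoms P = {q : P | ⊥ ⋖ q}.ncard := by
  simp only [numAtoms, bot_covBy_iff]
  rfl

theorem coeff_succ_mul_one_sub_C_mul_X {R : Type*} [CommRing R]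
    (f : PowerSeries R) (a : R) (i : ℕ) :
    PowerSeries.coeff (i + 1) (f * (1 - PowerSeries.C a * PowerSeries.X)) =
      PowerSeries.coeff (i + 1) f - a * PowerSeries.coeff i f := by
  rw [mul_sub, mul_one, mul_left_comm, map_sub, PowerSeries.coeff_C_mul,
    PowerSeries.coeff_succ_mul_X]

namespace UniformSupersolvableSeq

variable {L : ℕ → Type u} [∀ n, Lattice (L n)] [∀ n, BoundedOrder (L n)] [∀ n, Finite (L n)]
  (S : UniformSupersolvableSeq L)

/-! ### Counting covers -/

theorem strictMono_rank (n : ℕ) : StrictMono (S.rank n) :=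
  (S.geometric n).graded.rank_strictMono

theorem eq_bot_of_rank_eq_zero {n : ℕ} {x : L n} (hx : S.rank n x = 0) : x = ⊥ := by
  by_contra hne
  have := S.strictMono_rank n (bot_lt_iff_ne_bot.mpr hne)
  omega

theorem rank_t (n : ℕ) : S.rank (n + 1) (S.t n) = n := by
  have h := (S.geometric (n + 1)).graded.rank_covBy (S.isCoatom_t n).covBy_top
  rw [(S.geometric (n + 1)).graded.rank_top] at h
  omega

/-- Modularity of the coatom `t n`: meeting with it lowers the rank by exactly one outside
`[⊥, t n]`. -/
theorem rank_inf_t {n : ℕ} {q : L (n + 1)} (hq : ¬ q ≤ S.t n) :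
    S.rank (n + 1) q = S.rank (n + 1) (q ⊓ S.t n) + 1 := by
  have h := S.isModular_t n q
  have htop : S.t n ⊔ q = ⊤ := by
    refine (S.isCoatom_t n).2 _ (lt_of_le_of_ne le_sup_left fun h => hq ?_)
    rw [h]
    exact le_sup_right
  rw [htop, (S.geometric (n + 1)).graded.rank_top, S.rank_t, inf_comm] at h
  omega

theorem le_t_iff {n : ℕ} {q : L (n + 1)} : q ≤ S.t n ↔ ∃ x, S.ι n x = q := by
  rw [← Set.mem_Iic, ← S.range_ι, Set.mem_range]

theorem ι_le_t {n : ℕ} (x : L n) : S.ι n x ≤ S.t n :=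
  S.le_t_iff.mpr ⟨x, rfl⟩

theorem rank_θ {n : ℕ} {s : L (n + 1)} (hs : IsAtom s) (x : Set.Ici s) :
    S.rank (n + 1) x = S.rank n (S.θ n s hs x) + 1 := by
  have key : ∀ y : L (n + 1), ∀ hy : s ≤ y,
      S.rank (n + 1) y = S.rank n (S.θ n s hs ⟨y, hy⟩) + 1 := by
    intro y
    induction y using WellFoundedLT.induction with
    | ind y ih =>
      intro hy
      rcases hy.eq_or_lt with rfl | hlt
      · have h0 : S.θ n s hs ⟨s, hy⟩ = ⊥ :=
          le_bot_iff.mp ((S.θ n s hs).le_symm_apply.mp ((S.θ n s hs).symm ⊥).2)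
        rw [h0, (S.geometric n).graded.rank_bot,
          (S.geometric (n + 1)).graded.rank_covBy (bot_covBy_iff.mpr hs),
          (S.geometric (n + 1)).graded.rank_bot]
      · obtain ⟨z, hsz, hzy⟩ := exists_le_covBy_of_lt hlt
        have hcov : (⟨z, hsz⟩ : Set.Ici s) ⋖ ⟨y, hy⟩ :=
          ⟨hzy.lt, fun c h1 h2 => hzy.2 h1 h2⟩
        rw [(S.geometric (n + 1)).graded.rank_covBy hzy, ih z hzy.lt hsz,
          (S.geometric n).graded.rank_covBy ((apply_covBy_apply_iff (S.θ n s hs)).mpr hcov)]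
  exact key x x.2

/-- The upper interval above an element of rank `j` of `L (m + j)` has as many atoms as `L m`. -/
theorem ncard_covers (m j : ℕ) (r : L (m + j)) (hr : S.rank (m + j) r = j) :
    {q | r ⋖ q}.ncard = numAtoms (L m) := by
  induction j with
  | zero =>
    rw [S.eq_bot_of_rank_eq_zero hr, numAtoms_eq_ncard_covers_bot]
    rfl
  | succ j ih =>
    have hr0 : r ≠ ⊥ := by
      rintro rfl
      have := (S.geometric (m + j + 1)).graded.rank_bot
      have : S.rank (m + j + 1) ⊥ = j + 1 := hr
      omega
    obtain ⟨s, hs, hsr⟩ := (IsAtomic.eq_bot_or_exists_atom_le r).resolve_left hr0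
    let e := S.θ (m + j) s hs
    let f : L (m + j) ↪o L (m + j + 1) :=
      e.symm.toOrderEmbedding.trans (OrderEmbedding.subtype (· ∈ Set.Ici s))
    have hf : ∀ x (hx : s ≤ x), f (e ⟨x, hx⟩) = x := fun x hx => by simp [f]
    have hrange : Set.range f = Set.Ici s := by
      ext x
      constructor
      · rintro ⟨y, rfl⟩
        exact (e.symm y).2
      · exact fun hx => ⟨e ⟨x, hx⟩, hf x hx⟩
    have h := ncard_covers_mem_range f (hrange ▸ Set.ordConnected_Ici) (e ⟨r, hsr⟩)
    have hrank : S.rank (m + j) (e ⟨r, hsr⟩) = j :=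
      Nat.succ_injective ((S.rank_θ hs ⟨r, hsr⟩).symm.trans hr)
    rw [hf, hrange, ih _ hrank] at h
    rw [← h]
    congr 1
    ext q
    exact ⟨fun hq => ⟨hq, hsr.trans hq.le⟩, fun hq => hq.1⟩

/-- The number of covers of `r ∈ L (m + j)` in `L (m + j + 1)` which do not lie in `L (m + j)`, for
`r` of rank `j`. -/
theorem ncard_covers_not_le_t (m j : ℕ) (r : L (m + j)) (hr : S.rank (m + j) r = j) :
    ({q | S.ι (m + j) r ⋖ q ∧ ¬ q ≤ S.t (m + j)}.ncard : ℤ) = atomDiff L (m + 1) := by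
  have hin := ncard_covers_mem_range (S.ι (m + j)) (S.range_ι _ ▸ Set.ordConnected_Iic) r
  rw [S.ncard_covers m j r hr, S.range_ι] at hin
  have hall : {q | S.ι (m + j) r ⋖ q}.ncard = numAtoms (L (m + 1)) := by
    have key : ∀ N (hN : N = m + 1 + j) (x : L N), S.rank N x = j →
        {q | x ⋖ q}.ncard = numAtoms (L (m + 1)) := by
      rintro N rfl x hx
      exact S.ncard_covers (m + 1) j x hx
    exact key _ (by omega) _ ((S.rank_ι _ r).trans hr)
  have hsplit : {q | S.ι (m + j) r ⋖ q} =
      {q | S.ι (m + j) r ⋖ q ∧ q ∈ Set.Iic (S.t (m + j))} ∪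
        {q | S.ι (m + j) r ⋖ q ∧ ¬ q ≤ S.t (m + j)} := by
    ext q
    simp only [Set.mem_ofPred_eq, Set.mem_union, Set.mem_Iic]
    tauto
  rw [hsplit, Set.ncard_union_eq (Set.disjoint_left.mpr fun q h1 h2 => h2.2 h1.2)
    (Set.toFinite _) (Set.toFinite _), hin] at hall
  rw [atomDiff, Nat.add_sub_cancel]
  omega

/-! ### The recursion for the numbers of elements of each rank -/

/-- The number of elements of rank `i` of `L n`, the Whitney number of the second kind. -/
noncomputable def rankCount (n i : ℕ) : ℕ :=
  {x : L n | S.rank n x = i}.ncard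

theorem rankCount_eq_zero {n i : ℕ} (h : n < i) : S.rankCount n i = 0 := by
  rw [rankCount, Set.ncard_eq_zero]
  ext x
  have := (S.geometric n).graded.rank_le x
  simp only [Set.mem_ofPred_eq, Set.mem_empty_iff_false, iff_false]
  omega

theorem rankCount_zero (n : ℕ) : S.rankCount n 0 = 1 := by
  rw [rankCount, Set.ncard_eq_one]
  exact ⟨⊥, Set.eq_singleton_iff_unique_mem.mpr
    ⟨(S.geometric n).graded.rank_bot, fun x hx => S.eq_bot_of_rank_eq_zero hx⟩⟩

/-- The elements `q` of rank `i + 1` outside `[⊥, t n]` are fibred by `q ↦ q ⊓ t n` over the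
elements of rank `i` of `L n`; the fibres consist of covers. -/
theorem ncard_rank_not_le_t (m i : ℕ) :
    ({q | S.rank (m + i + 1) q = i + 1 ∧ ¬ q ≤ S.t (m + i)}.ncard : ℤ) =
      atomDiff L (m + 1) * S.rankCount (m + i) i := by
  let f : (Σ r : {r : L (m + i) // S.rank (m + i) r = i},
        {q | S.ι (m + i) r ⋖ q ∧ ¬ q ≤ S.t (m + i)}) →
      {q | S.rank (m + i + 1) q = i + 1 ∧ ¬ q ≤ S.t (m + i)} := fun x =>
    ⟨x.2.1, by rw [(S.geometric _).graded.rank_covBy x.2.2.1, S.rank_ι, x.1.2], x.2.2.2⟩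
  have hinf : ∀ x, (f x).1 ⊓ S.t (m + i) = S.ι (m + i) x.1.1 := by
    rintro ⟨⟨r, hr⟩, ⟨q, hq, hqt⟩⟩
    have hle : S.ι (m + i) r ≤ q ⊓ S.t (m + i) := le_inf hq.le (S.ι_le_t r)
    refine (hle.eq_of_not_lt fun hlt => hq.2 hlt ?_).symm
    exact lt_of_le_of_ne inf_le_left fun h => hqt (h ▸ inf_le_right)
  have hf : Function.Bijective f := by
    constructor
    · intro x y hxy
      have h1 : x.1 = y.1 := Subtype.ext ((S.ι (m + i)).injective (by rw [← hinf, ← hinf, hxy]))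
      have h2 : x.2.1 = y.2.1 := congrArg Subtype.val hxy
      obtain ⟨r, q⟩ := x
      obtain ⟨r', q'⟩ := y
      obtain rfl : r = r' := h1
      obtain rfl : q = q' := Subtype.ext h2
      rfl
    · rintro ⟨q, hq, hqt⟩
      obtain ⟨r, hr⟩ := S.le_t_iff.mp (inf_le_right : q ⊓ S.t (m + i) ≤ S.t (m + i))
      have hrk := S.rank_inf_t hqt
      have hri : S.rank (m + i) r = i := by
        rw [← S.rank_ι, hr]
        omega
      exact ⟨⟨⟨r, hri⟩, ⟨q, hr ▸ (S.geometric _).graded.covBy_of_rank inf_le_left hrk, hqt⟩⟩, rfl⟩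
  have := Fintype.ofFinite {r : L (m + i) // S.rank (m + i) r = i}
  rw [← Nat.card_coe_set_eq, ← Nat.card_eq_of_bijective f hf, Nat.card_sigma]
  simp only [Nat.card_coe_set_eq]
  push_cast
  rw [Finset.sum_congr rfl fun r _ => S.ncard_covers_not_le_t m i r.1 r.2, Finset.sum_const,
    Finset.card_univ, ← Nat.card_eq_fintype_card, nsmul_eq_mul, mul_comm]
  rfl

theorem rankCount_succ_succ (m i : ℕ) :
    (S.rankCount (m + i + 1) (i + 1) : ℤ) =
      S.rankCount (m + i) (i + 1) + atomDiff L (m + 1) * S.rankCount (m + i) i := by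
  have hsplit : {q | S.rank (m + i + 1) q = i + 1} =
      S.ι (m + i) '' {x | S.rank (m + i) x = i + 1} ∪
        {q | S.rank (m + i + 1) q = i + 1 ∧ ¬ q ≤ S.t (m + i)} := by
    ext q
    simp only [Set.mem_ofPred_eq, Set.mem_union, Set.mem_image]
    constructor
    · intro hq
      by_cases hqt : q ≤ S.t (m + i)
      · obtain ⟨x, rfl⟩ := S.le_t_iff.mp hqt
        exact Or.inl ⟨x, by rwa [S.rank_ι] at hq, rfl⟩
      · exact Or.inr ⟨hq, hqt⟩
    · rintro (⟨x, hx, rfl⟩ | hq)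
      · rwa [S.rank_ι]
      · exact hq.1
  have hdisj : Disjoint (S.ι (m + i) '' {x | S.rank (m + i) x = i + 1})
      {q | S.rank (m + i + 1) q = i + 1 ∧ ¬ q ≤ S.t (m + i)} := by
    refine Set.disjoint_left.mpr ?_
    rintro _ ⟨x, -, rfl⟩ hx
    exact hx.2 (S.ι_le_t x)
  rw [← S.ncard_rank_not_le_t, rankCount, rankCount, hsplit,
    Set.ncard_union_eq hdisj (Set.toFinite _) (Set.toFinite _),
    Set.ncard_image_of_injective _ (S.ι (m + i)).injective]
  push_cast
  rfl

/-- The generating function of the Whitney numbers `W (m + i, i)`: multiplying it by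
`1 - a_{m + 1} x` lowers `m` by one. -/
theorem mk_rankCount_mul_prod (m : ℕ) :
    (PowerSeries.mk fun i => (S.rankCount (m + i) i : ℚ)) *
      ∏ i ∈ Finset.Icc 1 (m + 1),
        (1 - PowerSeries.C (atomDiff L i : ℚ) * PowerSeries.X : PowerSeries ℚ) = 1 := by
  have hrec : ∀ m i : ℕ, (S.rankCount (m + (i + 1)) (i + 1) : ℚ) =
      S.rankCount (m + i) (i + 1) + (atomDiff L (m + 1) : ℚ) * S.rankCount (m + i) i :=
    fun m i => by exact_mod_cast S.rankCount_succ_succ m i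
  induction m with
  | zero =>
    rw [Finset.Icc_self, Finset.prod_singleton]
    ext i
    cases i with
    | zero => simp [S.rankCount_zero]
    | succ i =>
      rw [coeff_succ_mul_one_sub_C_mul_X, PowerSeries.coeff_mk, PowerSeries.coeff_mk,
        hrec, S.rankCount_eq_zero (by omega)]
      simp [PowerSeries.coeff_one]
  | succ m ih =>
    rw [Finset.prod_Icc_succ_top (by omega), mul_comm (∏ i ∈ _, _), ← mul_assoc]
    refine Eq.trans (congrArg (· * _) ?_) ih
    ext i
    cases i with
    | zero => simp [S.rankCount_zero]
    | succ i =>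
      rw [coeff_succ_mul_one_sub_C_mul_X, PowerSeries.coeff_mk, PowerSeries.coeff_mk,
        PowerSeries.coeff_mk, hrec, add_sub_cancel_right, show m + 1 + i = m + (i + 1) by omega]

/-! ### Representatives in the limit -/

theorem ν_toLimit_le (n : ℕ) (x : L n) : S.ν (S.toLimit n x) ≤ n :=
  Nat.sInf_le ⟨x, rfl⟩

theorem ν_le_iff {p : S.Limit} {n : ℕ} : S.ν p ≤ n ↔ ∃ x : L n, S.toLimit n x = p := by
  constructor
  · intro h
    obtain ⟨x, hx⟩ : S.ν p ∈ {n : ℕ | ∃ x : L n, S.toLimit n x = p} :=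
      Nat.sInf_mem (S.exists_toLimit p)
    exact ⟨S.up h x, by rw [S.toLimit_up, hx]⟩
  · rintro ⟨x, rfl⟩
    exact S.ν_toLimit_le n x

theorem ν_mono {p q : S.Limit} (h : p ≤ q) : S.ν p ≤ S.ν q := by
  obtain ⟨n, x, y, rfl, rfl, hxy⟩ := h
  rw [S.ν_le_iff]
  obtain ⟨z, hz⟩ := S.ν_le_iff.mp (le_refl (S.ν (S.toLimit n y)))
  -- each `L m` is a lower set in `L (m + 1)`, hence in all later lattices
  have key : ∀ (m l : ℕ) (hml : m ≤ l) (z : L m) (w : L l), w ≤ S.up hml z →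
      ∃ v, S.up hml v = w := by
    intro m l hml z
    induction l, hml using Nat.le_induction with
    | base => exact fun w _ => ⟨w, S.up_self w⟩
    | succ l hl ih =>
      intro w hw
      rw [S.up_succ hl] at hw
      obtain ⟨w', rfl⟩ := S.le_t_iff.mp (hw.trans (S.ι_le_t _))
      obtain ⟨v, rfl⟩ := ih w' ((S.ι l).le_iff_le.mp hw)
      exact ⟨v, S.up_succ hl v⟩
  have hν := S.ν_toLimit_le n y
  have hy : S.up hν z = y := S.toLimit_injective _ (by rw [S.toLimit_up, hz])
  obtain ⟨v, hv⟩ := key _ n hν z x (hxy.trans_eq hy.symm)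
  exact ⟨v, by rw [← hv, S.toLimit_up]⟩

theorem limitRank_toLimit (n : ℕ) (x : L n) : S.limitRank (S.toLimit n x) = S.rank n x :=
  rfl

theorem limitRank_strictMono : StrictMono S.limitRank := by
  intro p q hpq
  obtain ⟨n, x, y, rfl, rfl, -⟩ := hpq.le
  exact S.strictMono_rank n (lt_of_le_not_ge (S.toLimit_le_toLimit.mp hpq.le)
    fun h => hpq.not_ge (S.toLimit_le_toLimit.mpr h))

theorem toLimit_lt_toLimit {n : ℕ} {x y : L n} : S.toLimit n x < S.toLimit n y ↔ x < y := by
  simp only [lt_iff_le_not_ge, S.toLimit_le_toLimit]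

theorem le_t_iff_ν_le {n : ℕ} {x : L (n + 1)} :
    x ≤ S.t n ↔ S.ν (S.toLimit (n + 1) x) ≤ n := by
  rw [S.ν_le_iff, S.le_t_iff]
  refine exists_congr fun y => ⟨?_, fun h => ?_⟩
  · rintro rfl
    exact (S.toLimit_ι n y).symm
  · exact S.toLimit_injective _ (by rw [S.toLimit_ι, h])

/-! ### The trimmed limit is graded -/

theorem mem_trimmed {k : ℕ} {p : S.Limit} : p ∈ S.Trimmed k ↔ S.ν p < k + S.limitRank p := by
  rw [Trimmed, Set.mem_ofPred_eq]
  omega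

theorem exists_between_trimmed {k : ℕ} {p q : S.Limit} (hp : p ∈ S.Trimmed k)
    (hq : q ∈ S.Trimmed k) (hpq : p < q) (hr : S.limitRank p + 1 < S.limitRank q) :
    ∃ r ∈ S.Trimmed k, p < r ∧ r < q := by
  simp only [mem_trimmed] at *
  have hν := S.ν_mono hpq.le
  obtain ⟨n, hn⟩ : ∃ n, S.ν q = n := ⟨_, rfl⟩
  obtain ⟨y, rfl⟩ := S.ν_le_iff.mp hn.le
  obtain ⟨x, rfl⟩ := S.ν_le_iff.mp (hν.trans hn.le)
  rw [S.toLimit_lt_toLimit] at hpq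
  simp only [limitRank_toLimit] at *
  have hrank := (S.geometric n).graded.rank_le y
  obtain ⟨m, rfl⟩ : ∃ m, n = m + 1 := ⟨n - 1, by omega⟩
  -- the element `r` only has to have rank `ρ q - 1` and a sufficiently small `ν`
  suffices h : ∃ r : L (m + 1), x ≤ r ∧ r ⋖ y ∧
      S.ν (S.toLimit (m + 1) r) < k + S.rank (m + 1) r by
    obtain ⟨r, hxr, hry, hrk⟩ := h
    have := (S.geometric _).graded.rank_covBy hry
    refine ⟨S.toLimit (m + 1) r, hrk, S.toLimit_lt_toLimit.mpr ?_,
      S.toLimit_lt_toLimit.mpr hry.lt⟩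
    exact lt_of_le_of_ne hxr (by rintro rfl; omega)
  by_cases hxt : x ≤ S.t m
  · have hyt : ¬ y ≤ S.t m := by
      rw [S.le_t_iff_ν_le]
      omega
    have h1 := S.rank_inf_t hyt
    have h2 : S.ν (S.toLimit (m + 1) (y ⊓ S.t m)) ≤ m := S.le_t_iff_ν_le.mp inf_le_right
    exact ⟨y ⊓ S.t m, le_inf hpq.le hxt, (S.geometric _).graded.covBy_of_rank inf_le_left h1,
      by omega⟩
  · rw [S.le_t_iff_ν_le] at hxt
    obtain ⟨r, hxr, hry⟩ := exists_le_covBy_of_lt hpq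
    have h1 := (S.geometric _).graded.rank_covBy hry
    have h2 := S.ν_toLimit_le _ r
    exact ⟨r, hxr, hry, by omega⟩

theorem exists_gt_trimmed {k : ℕ} {p : S.Limit} (hp : p ∈ S.Trimmed k) :
    ∃ q ∈ S.Trimmed k, p < q := by
  simp only [mem_trimmed] at *
  obtain ⟨n, hn⟩ : ∃ n, S.ν p = n := ⟨_, rfl⟩
  obtain ⟨x, rfl⟩ := S.ν_le_iff.mp hn.le
  have := (S.geometric (n + 1)).atomic
  obtain ⟨s, hs, -, hst⟩ : ∃ s : L (n + 1), IsAtom s ∧ s ≤ ⊤ ∧ ¬ s ≤ S.t n := by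
    by_contra! h
    exact (S.isCoatom_t n).1 (top_le_iff.mp (le_iff_atom_le_imp.mpr h))
  have hsx : ¬ s ≤ S.ι n x := fun h => hst (h.trans (S.ι_le_t x))
  have hlt : S.ι n x < S.ι n x ⊔ s := left_lt_sup.mpr hsx
  refine ⟨S.toLimit (n + 1) (S.ι n x ⊔ s), ?_, ?_⟩
  · have h1 := S.strictMono_rank _ hlt
    have h2 := S.ν_toLimit_le _ (S.ι n x ⊔ s)
    rw [S.rank_ι] at h1
    rw [S.limitRank_toLimit] at *
    omega
  · rw [← S.toLimit_ι, S.toLimit_lt_toLimit]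
    exact hlt

end UniformSupersolvableSeq

/-- A criterion for gradedness: below every element there are only finitely many ranks, so a maximal
chain meets every rank as soon as it cannot stop and cannot skip a rank. -/
theorem isNatGradedBy_of_strictMono {P : Type*} [PartialOrder P] {ρ : P → ℕ} (hρ : StrictMono ρ)
    {b : P} (hb : IsBot b) (hb0 : ρ b = 0) (hgt : ∀ p : P, ∃ q, p < q)
    (hbetween : ∀ p q : P, p < q → ρ p + 1 < ρ q → ∃ r, p < r ∧ r < q) : IsNatGradedBy ρ := by
  refine ⟨b, hb, fun C hC => ?_⟩
  have hmem : ∀ r : P, (∀ c ∈ C, r ≤ c ∨ c ≤ r) → r ∈ C := by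
    intro r hr
    rw [hC.2 (hC.1.insert fun c hc _ => hr c hc) (Set.subset_insert r C)]
    exact Set.mem_insert r C
  have hlt : ∀ c ∈ C, ∀ d ∈ C, ρ c < ρ d → c < d := by
    intro c hc d hd h
    refine lt_of_le_of_ne ((hC.1.total hc hd).resolve_right fun h' => ?_) (by rintro rfl; omega)
    exact absurd (hρ.monotone h') (not_le.mpr h)
  have hinj : ∀ c ∈ C, ∀ d ∈ C, ρ c = ρ d → c = d := by
    intro c hc d hd h
    by_contra hne
    rcases hC.1.total hc hd with h' | h'
    · exact (hρ (lt_of_le_of_ne h' hne)).ne h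
    · exact (hρ (lt_of_le_of_ne h' (Ne.symm hne))).ne h.symm
  have hex : ∀ i, ∃ c ∈ C, ρ c = i := by
    intro i
    induction i with
    | zero => exact ⟨b, hmem b fun c _ => Or.inl (hb c), hb0⟩
    | succ i ih =>
      obtain ⟨c, hc, rfl⟩ := ih
      have hne : ∃ j, ∃ d ∈ C, c < d ∧ ρ d = j := by
        by_contra! h
        obtain ⟨q, hq⟩ := hgt c
        refine h _ q (hmem q fun d hd => Or.inr ?_) hq rfl
        refine ((hC.1.total hc hd).elim (fun h' => ?_) id).trans hq.le
        by_contra h''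
        exact h _ d hd (lt_of_le_of_ne h' fun e => h'' e.ge) rfl
      -- the next element `d` of the chain after `c`
      classical
      obtain ⟨d, hd, hcd, hdj⟩ := Nat.find_spec hne
      refine ⟨d, hd, ?_⟩
      have h1 := hρ hcd
      by_contra hskip
      obtain ⟨r, hcr, hrd⟩ := hbetween c d hcd (by omega)
      have hr : r ∈ C := by
        refine hmem r fun e he => ?_
        rcases hC.1.total hc he with h' | h'
        · rcases h'.eq_or_lt with rfl | h'
          · exact Or.inr hcr.le
          · have := Nat.find_min' hne ⟨e, he, h', rfl⟩
            rcases hC.1.total hd he with h2 | h2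
            · exact Or.inl (hrd.le.trans h2)
            · rcases h2.eq_or_lt with rfl | h2
              · exact Or.inl hrd.le
              · have := hρ h2
                omega
        · exact Or.inr (h'.trans hcr.le)
      have := Nat.find_min' hne ⟨r, hr, hcr, rfl⟩
      have := hρ hrd
      omega
  choose x hxC hxr using hex
  refine ⟨x, hinj _ (hxC 0) _ (hmem b fun c _ => Or.inl (hb c)) (by rw [hxr, hb0]), fun i => ?_,
    hxr, ?_⟩
  · refine ⟨hlt _ (hxC i) _ (hxC (i + 1)) (by rw [hxr, hxr]; omega), fun r h1 h2 => ?_⟩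
    have := hρ h1
    have := hρ h2
    rw [hxr] at *
    omega
  · ext c
    constructor
    · exact fun hc => ⟨ρ c, hinj _ (hxC _) _ hc (hxr _)⟩
    · rintro ⟨i, rfl⟩
      exact hxC i

namespace UniformSupersolvableSeq

variable {L : ℕ → Type u} [∀ n, Lattice (L n)] [∀ n, BoundedOrder (L n)] [∀ n, Finite (L n)]
  (S : UniformSupersolvableSeq L)

theorem isNatGradedBy_trimmedRank {k : ℕ} (hk : 1 ≤ k) : IsNatGradedBy (S.trimmedRank k) := by
  have hbot : S.limitRank (S.toLimit 0 ⊥) = 0 := (S.geometric 0).graded.rank_bot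
  have hmem : S.toLimit 0 ⊥ ∈ S.Trimmed k := by
    have := S.ν_toLimit_le 0 ⊥
    rw [S.mem_trimmed]
    omega
  refine isNatGradedBy_of_strictMono (b := ⟨_, hmem⟩) (fun p q h => S.limitRank_strictMono h) ?_
    hbot ?_ ?_
  · rintro ⟨p, hp⟩
    obtain ⟨n, x, rfl⟩ := S.exists_toLimit p
    have h0 : S.up (Nat.zero_le n) ⊥ = ⊥ := by
      refine S.eq_bot_of_rank_eq_zero ?_
      rw [← S.limitRank_toLimit, S.toLimit_up, hbot]
    have hle : S.toLimit 0 ⊥ ≤ S.toLimit n x := by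
      rw [← S.toLimit_up (Nat.zero_le n), h0]
      exact S.toLimit_le_toLimit.mpr bot_le
    exact hle
  · rintro ⟨p, hp⟩
    obtain ⟨q, hq, hpq⟩ := S.exists_gt_trimmed hp
    exact ⟨⟨q, hq⟩, hpq⟩
  · rintro ⟨p, hp⟩ ⟨q, hq⟩ hpq hr
    obtain ⟨r, hr, hpr, hrq⟩ := S.exists_between_trimmed hp hq hpq hr
    exact ⟨⟨r, hr⟩, hpr, hrq⟩

/-! ### Elements of given rank in the trimmed limit -/

/-- The elements of rank `i` of the trimmed limit are those of the lattice `L (m + i)`, where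
`m + 1 = k`. -/
theorem bijective_toLimit_trimmed (m i : ℕ) :
    Function.Bijective fun x : {x : L (m + i) | S.rank (m + i) x = i} =>
      (⟨⟨S.toLimit (m + i) x, S.mem_trimmed.mpr (by
        have := S.ν_toLimit_le _ x.1
        have h : S.limitRank (S.toLimit (m + i) x) = i := x.2
        omega)⟩, x.2⟩ : {p : S.Trimmed (m + 1) // S.trimmedRank (m + 1) p = i}) := by
  constructor
  · intro x y h
    exact Subtype.ext (S.toLimit_injective _ (congrArg (fun p => p.1.1) h))
  · rintro ⟨⟨p, hp⟩, hpi⟩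
    have hpi' : S.limitRank p = i := hpi
    have hν := S.mem_trimmed.mp hp
    obtain ⟨x, rfl⟩ := S.ν_le_iff.mp (show S.ν p ≤ m + i by omega)
    exact ⟨⟨x, hpi'⟩, rfl⟩

end UniformSupersolvableSeq

theorem mainTheorem4 {L : ℕ → Type u} [∀ n, Lattice (L n)] [∀ n, BoundedOrder (L n)]
    [∀ n, Finite (L n)] (S : UniformSupersolvableSeq L) (k : ℕ) (hk : 1 ≤ k) :
    IsNatGradedBy (S.trimmedRank k) ∧ IsFiniteType (S.trimmedRank k) ∧
      rankGenFun (S.trimmedRank k) =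
        (∏ i ∈ Finset.Icc 1 k,
          (1 - PowerSeries.C (atomDiff L i : ℚ) * PowerSeries.X : PowerSeries ℚ))⁻¹ := by
  obtain ⟨m, rfl⟩ : ∃ m, k = m + 1 := ⟨k - 1, by omega⟩
  refine ⟨S.isNatGradedBy_trimmedRank hk,
    fun i => Finite.of_surjective _ (S.bijective_toLimit_trimmed m i).surjective, ?_⟩
  have hgen : rankGenFun (S.trimmedRank (m + 1)) =
      PowerSeries.mk fun i => (S.rankCount (m + i) i : ℚ) := by
    ext i
    rw [rankGenFun, PowerSeries.coeff_mk, PowerSeries.coeff_mk,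
      ← Nat.card_eq_of_bijective _ (S.bijective_toLimit_trimmed m i)]
    rfl
  rw [hgen, PowerSeries.eq_inv_iff_mul_eq_one, S.mk_rankCount_mul_prod]
  -- the constant term of each factor is `1`, so the inverse is a genuine one
  simp [map_prod]
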